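/- A \emph{gyrogroup} is a nonempty set $G$ with a binary operation $\oplus$ such that: (G1) there is a unique identity $0\in G$ with $0\oplus a=a=a\oplus 0$ for all $a\in G$; (G2) each $x\in G$ has a unique inverse $\ominus x$ with $\ominus x\oplus x=0=x\oplus(\ominus x)$; (G3) there is a map $\operatorname{gyr}$ from $G\times G$ to the automorphisms of $(G,\oplus)$ with $x\oplus(y\oplus z)=(x\oplus y)\oplus\operatorname{gyr}[x,y](z)$ for all $x,y,z\in G$; (G4) $\operatorname{gyr}[x\oplus y,y]=\operatorname{gyr}[x,y]$ for all $x,y\in G$. A nonempty subset $H\subseteq G$ is a \emph{subgyrogroup} if it is closed under $\oplus$, for all $x,y\in H$ the restriction of $\operatorname{gyr}[x,y]$ to $H$ is a bijective homomorphism onto $\operatorname{gyr}[x,y](H)$, and $H$ is a gyrogroup under the restricted operation; $\langle S\rangle$ denotes the smallest subgyrogroup of $G$ containing $S\subseteq G$. A \emph{topological gyrogroup} is a gyrogroup with a topology for which $\oplus\colon G\times G\to G$ and $\ominus\colon G\to G$ are continuous. It is a \emph{strongly topological gyrogroup} if there is a neighborhood base $\mathscr U$ of $0$ such that $\operatorname{gyr}[x,y](U)=U$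 for all $x,y\in G$ and $U\in\mathscr U$. A subset $S$ of a topological gyrogroup $G$ is a \emph{suitable set} for $G$ if $S$ is discrete in the subspace topology, $\langle S\rangle$ is dense in $G$, and $S\cup\{0\}$ is closed in $G$. A topological space $X$ is a \emph{$\sigma$-space} if it has a $\sigma$-locally finite network, i.e. a family $\mathscr N=\bigcup_{n\in\mathbb N}\mathscr N_n$ of subsets of $X$, with each $\mathscr N_n$ locally finite, such that for every open $U\subseteq X$ and every $x\in U$ there is $N\in\mathscr N$ with $x\in N\subseteq U$. \textbf{Corollary.} Let $G$ be a Hausdorff strongly topological gyrogroup. If $G$ is a separable $\sigma$-space, then $G$ has a suitable set. -/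

import Mathlib

open Set Topology

universe u

/-- A gyrogroup, written additively (`x + y` is `x ⊕ y`, `-x` is `⊖x`): a two-sided identity,
two-sided inverses, and gyroautomorphisms `gyr x y` of the magma `(G, +)` which satisfy the left
gyroassociative law and the left loop property.  The identity, the inverses and the maps `gyr x y`
are determined by the addition, see `Gyrogroup.zero_unique`, `Gyrogroup.neg_unique` and
`Gyrogroup.gyr_apply`. -/
class Gyrogroup (G : Type u) extends AddZeroClass G, Neg G where
  neg_add_self : ∀ x : G, -x + x = 0
  add_neg_self : ∀ x : G, x + -x = 0
  gyr : G → G → (G ≃+ G)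
  gyr_assoc : ∀ x y z : G, x + (y + z) = (x + y) + gyr x y z
  gyr_loop : ∀ x y : G, gyr (x + y) y = gyr x y

namespace Gyrogroup

variable {G : Type u} [Gyrogroup G]

theorem add_left_cancel' {x y z : G} (h : x + y = x + z) : y = z := by
  have h1 : -x + (x + y) = -x + (x + z) := by rw [h]
  rw [gyr_assoc, gyr_assoc, neg_add_self, zero_add, zero_add] at h1
  exact (gyr (-x) x).injective h1

theorem gyr_zero_left (x z : G) : gyr 0 x z = z := by
  have h := gyr_assoc 0 x z
  rw [zero_add, zero_add] at h
  exact (add_left_cancel' h).symm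

theorem neg_add_cancel_left' (x y : G) : -x + (x + y) = y := by
  rw [gyr_assoc, ← gyr_loop, neg_add_self, zero_add, gyr_zero_left]

theorem neg_neg' (x : G) : - -x = x := by
  have h := neg_add_cancel_left' (-x) x
  rwa [neg_add_self, add_zero] at h

theorem add_neg_cancel_left' (x y : G) : x + (-x + y) = y := by
  have h := neg_add_cancel_left' (-x) y
  rwa [neg_neg'] at h

theorem zero_unique {e : G} (h : ∀ x : G, e + x = x) : e = 0 := by
  have := h 0
  rwa [add_zero] at this

theorem neg_unique {x y : G} (h : x + y = 0) : y = -x :=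
  add_left_cancel' (h.trans (add_neg_self x).symm)

theorem gyr_apply (x y z : G) : gyr x y z = -(x + y) + (x + (y + z)) := by
  rw [gyr_assoc x y z, neg_add_cancel_left']

/-- A subgyrogroup: a nonempty subset `H`, closed under `+`, such that each `gyr x y` with
`x, y ∈ H` restricts to a bijective homomorphism of `H` onto `gyr x y '' H`, and such that `H` with
the restricted addition is a gyrogroup. -/
structure IsSubgyrogroup (H : Set G) : Prop where
  nonempty : H.Nonempty
  add_mem : ∀ x ∈ H, ∀ y ∈ H, x + y ∈ H
  gyr_bijOn : ∀ x ∈ H, ∀ y ∈ H, BijOn (gyr x y) H (gyr x y '' H)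
  gyr_add : ∀ x ∈ H, ∀ y ∈ H, ∀ a ∈ H, ∀ b ∈ H, gyr x y (a + b) = gyr x y a + gyr x y b
  gyrogroup : ∃ _ : Gyrogroup H, ∀ a b : H, ((a + b : H) : G) = (a : G) + (b : G)

/-- The subgyrogroup criterion: closure under addition and inversion. -/
theorem isSubgyrogroup_iff {H : Set G} :
    IsSubgyrogroup H ↔
      H.Nonempty ∧ (∀ x ∈ H, ∀ y ∈ H, x + y ∈ H) ∧ ∀ x ∈ H, -x ∈ H := by
  constructor
  · intro h
    refine ⟨h.nonempty, h.add_mem, fun x hx => ?_⟩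
    obtain ⟨g, hg⟩ := h.gyrogroup
    have h0 : ((0 : H) : G) = 0 := by
      have h1 := hg 0 0
      rw [add_zero] at h1
      exact add_left_cancel' (h1.symm.trans (add_zero _).symm)
    have h2 := hg ⟨x, hx⟩ (-⟨x, hx⟩)
    rw [add_neg_self, h0] at h2
    rw [← neg_unique h2.symm]
    exact Subtype.property _
  · rintro ⟨hne, hadd, hneg⟩
    have h0 : (0 : G) ∈ H := by
      obtain ⟨x, hx⟩ := hne
      rw [← neg_add_self x]
      exact hadd _ (hneg _ hx) _ hx
    have hgyr : ∀ x ∈ H, ∀ y ∈ H, ∀ z, gyr x y z ∈ H ↔ z ∈ H := by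
      intro x hx y hy z
      constructor
      · intro h
        have e : z = -y + (-x + ((x + y) + gyr x y z)) := by
          rw [← gyr_assoc, neg_add_cancel_left', neg_add_cancel_left']
        rw [e]
        exact hadd _ (hneg _ hy) _ (hadd _ (hneg _ hx) _ (hadd _ (hadd _ hx _ hy) _ h))
      · intro h
        rw [gyr_apply]
        exact hadd _ (hneg _ (hadd _ hx _ hy)) _ (hadd _ hx _ (hadd _ hy _ h))
    refine ⟨hne, hadd, fun x _ y _ => (gyr x y).injective.injOn.bijOn_image,
      fun x _ y _ a _ b _ => map_add _ a b, ?_⟩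
    letI : AddZeroClass H :=
      { zero := ⟨0, h0⟩
        add := fun a b => ⟨a.1 + b.1, hadd _ a.2 _ b.2⟩
        zero_add := fun a => Subtype.ext (zero_add a.1)
        add_zero := fun a => Subtype.ext (add_zero a.1) }
    refine ⟨{ neg := fun a => ⟨-a.1, hneg _ a.2⟩
              neg_add_self := fun a => Subtype.ext (neg_add_self a.1)
              add_neg_self := fun a => Subtype.ext (add_neg_self a.1)
              gyr := fun a b =>
                { toEquiv := (gyr a.1 b.1).toEquiv.subtypeEquiv
                    fun z => (hgyr _ a.2 _ b.2 z).symm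
                  map_add' := fun z w => Subtype.ext (map_add (gyr a.1 b.1) z.1 w.1) }
              gyr_assoc := fun a b c => Subtype.ext (gyr_assoc a.1 b.1 c.1)
              gyr_loop := fun a b => AddEquiv.ext fun z => Subtype.ext
                (congrArg (fun f : G ≃+ G => f z.1) (gyr_loop a.1 b.1)) }, fun a b => rfl⟩

/-- The subgyrogroup `⟨S⟩` generated by `S`: the intersection of all subgyrogroups containing
`S`. -/
def closure (S : Set G) : Set G := ⋂₀ {H | IsSubgyrogroup H ∧ S ⊆ H}

theorem IsSubgyrogroup.zero_mem {H : Set G} (h : IsSubgyrogroup H) : (0 : G) ∈ H := by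
  obtain ⟨⟨x, hx⟩, hadd, hneg⟩ := isSubgyrogroup_iff.1 h
  rw [← neg_add_self x]
  exact hadd _ (hneg _ hx) _ hx

theorem isSubgyrogroup_closure (S : Set G) : IsSubgyrogroup (closure S) :=
  isSubgyrogroup_iff.2 ⟨⟨0, fun _ hH => hH.1.zero_mem⟩,
    fun x hx y hy H hH => hH.1.add_mem x (hx H hH) y (hy H hH),
    fun x hx H hH => (isSubgyrogroup_iff.1 hH.1).2.2 x (hx H hH)⟩

theorem subset_closure (S : Set G) : S ⊆ closure S := fun _ hx _ hH => hH.2 hx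

end Gyrogroup

/-- A topological gyrogroup: addition is jointly continuous and inversion is continuous. -/
class IsTopologicalGyrogroup (G : Type u) [TopologicalSpace G] [Gyrogroup G] : Prop
    extends ContinuousAdd G, ContinuousNeg G

/-- A strongly topological gyrogroup: the identity has a neighborhood base consisting of sets
that are mapped onto themselves by all gyroautomorphisms `gyr x y`. -/
class IsStronglyTopologicalGyrogroup (G : Type u) [TopologicalSpace G] [Gyrogroup G] : Prop
    extends IsTopologicalGyrogroup G where
  exists_gyr_invariant_basis : ∃ 𝒰 : Set (Set G), (𝓝 (0 : G)).HasBasis (fun U => U ∈ 𝒰) id ∧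
    ∀ U ∈ 𝒰, ∀ x y : G, Gyrogroup.gyr x y '' U = U

/-- A suitable set: discrete in itself, generating a dense subgyrogroup, and closed in `G` after
adjoining the identity. -/
structure IsSuitableSet {G : Type u} [TopologicalSpace G] [Gyrogroup G] (S : Set G) : Prop where
  isDiscrete : IsDiscrete S
  dense : Dense (Gyrogroup.closure S)
  isClosed : IsClosed (S ∪ {0})

/-- A network: for every point `x` of an open set `U` some member `N` has `x ∈ N ⊆ U`. -/
def IsNetwork {X : Type u} [TopologicalSpace X] (𝒩 : Set (Set X)) : Prop :=
  ∀ (x : X) (U : Set X), IsOpen U → x ∈ U → ∃ N ∈ 𝒩, x ∈ N ∧ N ⊆ U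

/-- A σ-space: a space with a network that is a countable union of locally finite families. -/
def IsSigmaSpace (X : Type u) [TopologicalSpace X] : Prop :=
  ∃ 𝒩 : ℕ → Set (Set X), (∀ n, LocallyFinite (fun N : 𝒩 n => (N : Set X))) ∧ IsNetwork (⋃ n, 𝒩 n)

/-! In a Hausdorff σ-space `{0}` is a countable intersection of neighborhoods, which refine to
gyration invariant `V n` with `V (n + 1) - V (n + 1) ⊆ V n`. If some `V n` has no finite cover by
left translates, choose pairs `x`, `d n + x` far from all earlier ones, with `d` a dense sequence:
the pairs form a locally finite set generating every `d n`. Otherwise, for finite `F n` with `F n +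
V n = G`, the differences from `F n` to `F (n + 1)` and `d n` that lie in `V n`, together with `F
0`, generate every `d n` and accumulate only at `0`. -/

namespace Gyrogroup

section Algebra

variable {G : Type u} [Gyrogroup G]

theorem neg_zero' : -(0 : G) = 0 := by
  have h := neg_add_self (0 : G)
  rwa [add_zero] at h

theorem gyr_neg (x y z : G) : gyr x y (-z) = -gyr x y z :=
  neg_unique (by rw [← map_add, add_neg_self, map_zero])

theorem add_add_gyr_neg (x y : G) : (x + y) + gyr x y (-y) = x := by
  rw [← gyr_assoc, add_neg_self, add_zero]

/-- Left translation changes the difference `-b + c` only by a gyration, so it preserves membership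
of differences in invariant sets. -/
theorem neg_add_add_left (a b c : G) : -(a + b) + (a + c) = gyr a b (-b + c) := by
  rw [gyr_apply, add_neg_cancel_left']

theorem IsSubgyrogroup.neg_mem {H : Set G} (h : IsSubgyrogroup H) {x : G} (hx : x ∈ H) :
    -x ∈ H :=
  (isSubgyrogroup_iff.1 h).2.2 x hx

/-- The loop property rewrites `gyr x y` as `gyr (x + y) y`, which expresses `x` through `x + y` and
`y` alone. -/
theorem IsSubgyrogroup.mem_of_add_mem {H : Set G} (h : IsSubgyrogroup H) {x y : G}
    (hy : y ∈ H) (hxy : x + y ∈ H) : x ∈ H := by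
  rw [← add_add_gyr_neg x y, ← gyr_loop, gyr_apply]
  have hy' := h.neg_mem hy
  exact h.add_mem _ hxy _ (h.add_mem _ (h.neg_mem (h.add_mem _ hxy _ hy)) _
    (h.add_mem _ hxy _ (h.add_mem _ hy _ hy')))

/-- A set mapped into itself by every gyroautomorphism. -/
def IsGyrInvariant (V : Set G) : Prop := ∀ x y : G, ∀ v ∈ V, gyr x y v ∈ V

end Algebra

section Topology

variable {G : Type u} [TopologicalSpace G] [Gyrogroup G]

theorem exists_isGyrInvariant_sub_mem [IsStronglyTopologicalGyrogroup G] {V : Set G}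
    (hV : V ∈ 𝓝 (0 : G)) :
    ∃ W ∈ 𝓝 (0 : G), IsGyrInvariant W ∧ (∀ v ∈ W, ∀ w ∈ W, v + -w ∈ V) ∧
      ∀ v ∈ W, ∀ w ∈ W, -v + w ∈ V := by
  obtain ⟨𝒰, hb, hinv⟩ :=
    IsStronglyTopologicalGyrogroup.exists_gyr_invariant_basis (G := G)
  have c1 : Filter.Tendsto (fun p : G × G => p.1 + -p.2) (𝓝 0 ×ˢ 𝓝 0) (𝓝 0) := by
    have : Continuous fun p : G × G => p.1 + -p.2 := by fun_prop
    have h := this.tendsto (0, 0)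
    rwa [neg_zero', add_zero, nhds_prod_eq] at h
  have c2 : Filter.Tendsto (fun p : G × G => -p.1 + p.2) (𝓝 0 ×ˢ 𝓝 0) (𝓝 0) := by
    have : Continuous fun p : G × G => -p.1 + p.2 := by fun_prop
    have h := this.tendsto (0, 0)
    rwa [neg_zero', add_zero, nhds_prod_eq] at h
  obtain ⟨W, hW, h⟩ := hb.prod_self.mem_iff.1 (Filter.inter_mem (c1 hV) (c2 hV))
  refine ⟨W, hb.mem_of_mem hW, fun x y v hv => ?_, fun v hv w hw => (h (mk_mem_prod hv hw)).1,
    fun v hv w hw => (h (mk_mem_prod hv hw)).2⟩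
  rw [← hinv W hW x y]
  exact mem_image_of_mem _ hv

theorem setOf_neg_add_mem_mem_nhds [IsTopologicalGyrogroup G] {V : Set G} (hV : V ∈ 𝓝 (0 : G))
    (y : G) : {z | -y + z ∈ V} ∈ 𝓝 y := by
  have hc : Continuous fun z : G => -y + z := by fun_prop
  have h := hc.tendsto y
  rw [neg_add_self] at h
  exact h hV

/-- By T1, finitely many unwanted points can be removed from a neighborhood. Discarding `0` from `S`
is harmless, since every subgyrogroup contains it. -/
theorem exists_isSuitableSet_of_finite_inter [T1Space G] {S : Set G}
    (hS : ∀ y : G, y ≠ 0 → ∃ U ∈ 𝓝 y, (U ∩ S).Finite) (hd : Dense (closure S)) :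
    ∃ S : Set G, IsSuitableSet S := by
  have key : ∀ y : G, y ≠ 0 → ∃ U ∈ 𝓝 y, ∀ z ∈ U, z ∈ S ∪ {0} → z = y := by
    intro y hy
    obtain ⟨U, hU, hf⟩ := hS y hy
    have hfin : (((U ∩ S) ∪ {0}) \ {y} : Set G).Finite := (hf.union (finite_singleton 0)).sdiff
    refine ⟨U ∩ (((U ∩ S) ∪ {0}) \ {y})ᶜ,
      Filter.inter_mem hU (hfin.isClosed.isOpen_compl.mem_nhds (by simp)), ?_⟩
    rintro z ⟨hz, hz'⟩ hzS
    by_contra hne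
    exact hz' ⟨hzS.imp (fun h => ⟨hz, h⟩) id, hne⟩
  refine ⟨S \ {0}, ?_, ?_, ?_⟩
  · rw [isDiscrete_iff_discreteTopology, discreteTopology_subtype_iff']
    rintro y ⟨hyS, hy⟩
    obtain ⟨U, hU, h⟩ := key y hy
    obtain ⟨O, hOU, hO, hyO⟩ := mem_nhds_iff.1 hU
    refine ⟨O, hO, Subset.antisymm (fun z hz => h z (hOU hz.1) (Or.inl hz.2.1)) ?_⟩
    rintro _ rfl
    exact ⟨hyO, hyS, hy⟩
  · refine hd.mono (?_ : closure S ⊆ closure (S \ {0}))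
    refine fun z hz H hH => hz H ⟨hH.1, fun x hx => ?_⟩
    by_cases h0 : x = 0
    · exact h0 ▸ hH.1.zero_mem
    · exact hH.2 ⟨hx, h0⟩
  · rw [sdiff_union_self, ← isOpen_compl_iff, isOpen_iff_mem_nhds]
    intro y hy
    obtain ⟨U, hU, h⟩ := key y fun h0 => hy (Or.inr h0)
    filter_upwards [hU] with z hz hzS
    exact hy (h z hz hzS ▸ hzS)

/-- If finitely many left translates of some gyration invariant neighborhood `V` of `0` never cover
`G`, then `G` has a suitable set. -/
theorem exists_isSuitableSet_of_not_finite_cover [T1Space G] [IsStronglyTopologicalGyrogroup G]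
    [TopologicalSpace.SeparableSpace G] {V : Set G} (hV : V ∈ 𝓝 (0 : G)) (hinv : IsGyrInvariant V)
    (hcov : ¬ ∃ F : Set G, F.Finite ∧ ∀ y, ∃ f ∈ F, -f + y ∈ V) :
    ∃ S : Set G, IsSuitableSet S := by
  classical
  obtain ⟨W, hW, hWinv, -, hWV⟩ := exists_isGyrInvariant_sub_mem hV
  let d : ℕ → G := TopologicalSpace.denseSeq G
  have step : ∀ (F : Finset G) (n : ℕ), ∃ x : G, ∀ f ∈ F, -f + x ∉ V ∧ -f + (d n + x) ∉ V := by
    intro F n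
    by_contra! h
    -- If no `x` works, the translates by `F` and `-d n + F` cover `G`.
    refine hcov ⟨(F ∪ F.image (fun f => -d n + f) : Finset G), Finset.finite_toSet _, fun x => ?_⟩
    obtain ⟨f, hf, hfx⟩ := h x
    by_cases h1 : -f + x ∈ V
    · exact ⟨f, by simp [hf], h1⟩
    · refine ⟨-d n + f, by simp; exact Or.inr ⟨f, hf, rfl⟩, ?_⟩
      have h2 := neg_add_add_left (-d n) f (d n + x)
      rw [neg_add_cancel_left'] at h2
      rw [h2]
      exact hinv _ _ _ (hfx h1)
  choose g hg using step
  let P : ℕ → Finset G := fun n =>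
    Nat.rec ∅ (fun n Q => Q ∪ {g Q n, d n + g Q n}) n
  have hP : ∀ n, P (n + 1) = P n ∪ {g (P n) n, d n + g (P n) n} := fun n => rfl
  have hmono : Monotone P := monotone_nat_of_le_succ fun n => by
    rw [hP]; exact Finset.subset_union_left
  let A : ℕ → Set G := fun n => {g (P n) n, d n + g (P n) n}
  have hsep : ∀ i j, i < j → ∀ s ∈ A i, ∀ t ∈ A j, -s + t ∉ V := by
    intro i j hij s hs t ht
    have hsP : s ∈ P j := hmono (Nat.succ_le_of_lt hij) (by
      rw [hP]
      rcases hs with rfl | rfl <;> simp)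
    rcases ht with rfl | rfl
    · exact (hg (P j) j s hsP).1
    · exact (hg (P j) j s hsP).2
  refine exists_isSuitableSet_of_finite_inter (S := ⋃ n, A n) (fun y _ =>
    ⟨_, setOf_neg_add_mem_mem_nhds hW y, ?_⟩) ?_
  · have hclose : ∀ s, -y + s ∈ W → ∀ t, -y + t ∈ W → -s + t ∈ V := by
      intro s hs t ht
      rw [← add_neg_cancel_left' y s, ← add_neg_cancel_left' y t, neg_add_add_left]
      exact hinv _ _ _ (hWV _ hs _ ht)
    by_cases he : ∃ i, ∃ s ∈ A i, -y + s ∈ W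
    · obtain ⟨i, s, hs, hsW⟩ := he
      refine (show (A i).Finite from toFinite _).subset ?_
      rintro t ⟨htW, ht⟩
      obtain ⟨j, hj⟩ := mem_iUnion.1 ht
      rcases lt_trichotomy i j with h | rfl | h
      · exact absurd (hclose s hsW t htW) (hsep i j h s hs t hj)
      · exact hj
      · exact absurd (hclose t htW s hsW) (hsep j i h t hj s hs)
    · refine finite_empty.subset ?_
      rintro t ⟨htW, ht⟩
      obtain ⟨j, hj⟩ := mem_iUnion.1 ht
      exact he ⟨j, t, hj, htW⟩
  · refine (TopologicalSpace.denseRange_denseSeq G).mono ?_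
    rintro _ ⟨n, rfl⟩
    refine (isSubgyrogroup_closure _).mem_of_add_mem (y := g (P n) n) ?_ ?_
    · exact subset_closure _ (mem_iUnion.2 ⟨n, Or.inl rfl⟩)
    · exact subset_closure _ (mem_iUnion.2 ⟨n, Or.inr rfl⟩)

/-- If `V n` are shrinking neighborhoods of `0` with intersection `{0}`, and finitely many left
translates of each `V n` cover `G`, then `G` has a suitable set. -/
theorem exists_isSuitableSet_of_finite_cover [T1Space G] [IsTopologicalGyrogroup G]
    [TopologicalSpace.SeparableSpace G] {V : ℕ → Set G} (hV : ∀ n, V n ∈ 𝓝 (0 : G))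
    (hinv : ∀ n, IsGyrInvariant (V n))
    (hsub : ∀ n, ∀ v ∈ V (n + 1), ∀ w ∈ V (n + 1), v + -w ∈ V n)
    (hzero : ∀ y, (∀ n, y ∈ V n) → y = 0)
    (hcov : ∀ n, ∃ F : Set G, F.Finite ∧ ∀ y, ∃ f ∈ F, -f + y ∈ V n) :
    ∃ S : Set G, IsSuitableSet S := by
  choose F hF hcov using hcov
  let d : ℕ → G := TopologicalSpace.denseSeq G
  have hanti : Antitone V := antitone_nat_of_succ_le fun n v hv => by
    have h := hsub n v hv 0 (mem_of_mem_nhds (hV _))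
    rwa [neg_zero', add_zero] at h
  -- `F (n + 1)` carries the induction, `d n` gives density, and `V n` forces accumulation only at
  -- `0`.
  let A : ℕ → Set G := fun n => image2 (fun f y => -f + y) (F n) (insert (d n) (F (n + 1))) ∩ V n
  have hA : ∀ n, (A n).Finite := fun n =>
    ((hF n).image2 _ ((hF (n + 1)).insert _)).inter_of_left _
  set S : Set G := F 0 ∪ ⋃ n, A n with hS
  have hadd : ∀ n, F n ⊆ closure S → ∀ y ∈ insert (d n) (F (n + 1)), y ∈ closure S := by
    intro n hn y hy
    obtain ⟨f, hf, hfy⟩ := hcov n y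
    rw [← add_neg_cancel_left' f y]
    exact (isSubgyrogroup_closure S).add_mem _ (hn hf) _
      (subset_closure S (Or.inr (mem_iUnion.2 ⟨n, mem_image2_of_mem hf hy, hfy⟩)))
  have hFS : ∀ n, F n ⊆ closure S := by
    intro n
    induction n with
    | zero => exact subset_union_left.trans (subset_closure S)
    | succ n ih => exact fun y hy => hadd n ih y (Or.inr hy)
  refine exists_isSuitableSet_of_finite_inter (S := S) (fun y hy => ?_) ?_
  · obtain ⟨n, hn⟩ : ∃ n, y ∉ V n := by
      by_contra! h
      exact hy (hzero y h)
    refine ⟨_, setOf_neg_add_mem_mem_nhds (hV (n + 1)) y,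
      ((hF 0).union ((finite_Iio (n + 1)).biUnion fun i _ => hA i)).subset ?_⟩
    rintro z ⟨hz, hzS | hzS⟩
    · exact Or.inl hzS
    · obtain ⟨i, hi⟩ := mem_iUnion.1 hzS
      refine Or.inr (mem_biUnion (x := i) ?_ hi)
      by_contra hlt
      -- A common point `z` of `V (n + 1)` and the translate of `V (n + 1)` by `y` would put `y` in
      -- `V n`.
      have hzV : z ∈ V (n + 1) := hanti (not_lt.1 hlt) hi.2
      refine hn ?_
      have h := add_add_gyr_neg y (-y + z)
      rw [add_neg_cancel_left', gyr_neg] at h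
      rw [← h]
      exact hsub n _ hzV _ (hinv _ _ _ _ hz)
  · refine (TopologicalSpace.denseRange_denseSeq G).mono ?_
    rintro _ ⟨n, rfl⟩
    exact hadd n (hFS n) _ (mem_insert _ _)

end Topology

end Gyrogroup

/-- In a Hausdorff σ-space every point is the intersection of countably many neighborhoods. -/
theorem IsSigmaSpace.exists_nhds_iInter_eq {X : Type u} [TopologicalSpace X] [T2Space X]
    (h : IsSigmaSpace X) (x : X) :
    ∃ U : ℕ → Set X, (∀ n, U n ∈ 𝓝 x) ∧ ∀ y, (∀ n, y ∈ U n) → y = x := by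
  obtain ⟨𝒩, hlf, hnet⟩ := h
  -- Local finiteness makes this union of closures closed.
  refine ⟨fun n => (⋃ N : {N : 𝒩 n // x ∉ closure (N : Set X)}, closure (N.1 : Set X))ᶜ,
    fun n => ?_, fun y hy => ?_⟩
  · have hcl : IsClosed (⋃ N : {N : 𝒩 n // x ∉ closure (N : Set X)}, closure (N.1 : Set X)) :=
      ((hlf n).closure.comp_injective Subtype.val_injective).isClosed_iUnion
        fun _ => isClosed_closure
    refine hcl.isOpen_compl.mem_nhds ?_
    simp only [mem_compl_iff, mem_iUnion, not_exists]
    exact fun N => N.2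
  · by_contra hne
    obtain ⟨U, V, hU, hV, hyU, hxV, hUV⟩ := t2_separation hne
    obtain ⟨N, hN, hyN, hNU⟩ := hnet y U hU hyU
    obtain ⟨n, hn⟩ := mem_iUnion.1 hN
    have hx : x ∉ closure N := fun hx =>
      (hUV.closure_left hV).le_bot ⟨closure_mono hNU hx, hxV⟩
    exact hy n (mem_iUnion.2 ⟨⟨⟨N, hn⟩, hx⟩, subset_closure hyN⟩)

open Gyrogroup in
/-- Every neighborhood sequence of `0` is refined by a shrinking sequence of gyration invariant
neighborhoods. -/
theorem exists_isGyrInvariant_seq {G : Type u} [TopologicalSpace G] [Gyrogroup G]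
    [IsStronglyTopologicalGyrogroup G] {U : ℕ → Set G} (hU : ∀ n, U n ∈ 𝓝 (0 : G)) :
    ∃ V : ℕ → Set G, (∀ n, V n ∈ 𝓝 (0 : G)) ∧ (∀ n, IsGyrInvariant (V n)) ∧
      (∀ n, ∀ v ∈ V (n + 1), ∀ w ∈ V (n + 1), v + -w ∈ V n) ∧ ∀ n, V (n + 1) ⊆ U n := by
  choose! W hW hinv hsub _ using fun V : Set G => exists_isGyrInvariant_sub_mem (V := V)
  let V : ℕ → Set G := fun n => Nat.rec (W univ) (fun n V => W (V ∩ U n)) n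
  have hV : ∀ n, V n ∈ 𝓝 (0 : G) := by
    intro n
    induction n with
    | zero => exact hW _ Filter.univ_mem
    | succ n ih => exact hW _ (Filter.inter_mem ih (hU n))
  have hVU : ∀ n, V n ∩ U n ∈ 𝓝 (0 : G) := fun n => Filter.inter_mem (hV n) (hU n)
  refine ⟨V, hV, fun n => ?_, fun n v hv w hw => (hsub _ (hVU n) v hv w hw).1, fun n v hv => ?_⟩
  · cases n with
    | zero => exact hinv _ Filter.univ_mem
    | succ n => exact hinv _ (hVU n)
  · have h := (hsub _ (hVU n) v hv 0 (mem_of_mem_nhds (hV (n + 1)))).2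
    rwa [neg_zero', add_zero] at h

theorem mainTheorem5 (G : Type u) [TopologicalSpace G] [T2Space G] [Gyrogroup G]
    [IsStronglyTopologicalGyrogroup G] [TopologicalSpace.SeparableSpace G]
    (hσ : IsSigmaSpace G) :
    ∃ S : Set G, IsSuitableSet S := by
  obtain ⟨U, hU, hU0⟩ := hσ.exists_nhds_iInter_eq (0 : G)
  obtain ⟨V, hV, hinv, hsub, hVU⟩ := exists_isGyrInvariant_seq hU
  by_cases hcov : ∀ n, ∃ F : Set G, F.Finite ∧ ∀ y, ∃ f ∈ F, -f + y ∈ V n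
  · exact Gyrogroup.exists_isSuitableSet_of_finite_cover hV hinv hsub
      (fun y hy => hU0 y fun n => hVU n (hy (n + 1))) hcov
  · obtain ⟨n, hn⟩ := not_forall.1 hcov
    exact Gyrogroup.exists_isSuitableSet_of_not_finite_cover (hV n) (hinv n) hn
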